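/- Let $\mathcal X$ be a set, let $f\sim\mathcal{GP}(m_0,k)$ be a Gaussian process on $\mathcal X$ whose kernel $k$ is positive definite (Gram matrices of distinct points are positive definite), let $X=(x_1,\dots,x_d)$ be distinct training points, and let $y=f(X)+\zeta$, where $\zeta\sim\mathcal N(0,\sigma^2 I)$ is independent of $f$ and $\sigma\in\mathbb R$. Put $G=k(X,X)+\sigma^2 I$ and $b=y-m_0(X)$. **Strong calibration.** Let a truth $u\in\mathbb R^n$ be drawn from a Gaussian prior, let data $y$ be generated from a data-generating model (for that truth), and let a learning procedure (for that fixed prior) map data $y$ to a Gaussian distribution $\mathcal N(\bar u(y),\bar\Sigma)$ whose possibly singular covariance $\bar\Sigma$ does not depend on $y$. Let $R$ and $N$ be matrices whose columns form (mutually) orthonormal bases of the row space and of the null space of $\bar\Sigma$. The procedure is *strongly calibrated* for this prior and data-generating model if $$(R^\top\bar\Sigma R)^{-1/2}R^\top(\bar u(y)-u)\sim\mathcal N(0,I)\qquad\text{and}\qquad N^\top(\bar u(y)-u)=0\ \text{ almost surely.}$$ **Solver.** A probabilistic linear solver is a deterministic map $\eta$ that takes a prior on $\mathbb R^d$ and a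 right-hand side $b\in\mathbb R^d$ to a probability distribution on $\mathbb R^d$. Suppose that, for the prior $\mathcal N(0,G^{-1})$ and every right-hand side $b$, it returns a Gaussian distribution $\eta_b=\mathcal N(\bar v(b),G^{-1}-D)$, where the matrix $D$ does not depend on $b$ (equivalently, on $y$) and $G^{-1}-D$ is positive semidefinite, possibly singular. Suppose that it is strongly calibrated for the prior $v\sim\mathcal N(0,G^{-1})$ and the data-generating model $b=Gv$. **Computation-aware posterior.** For a finite family $X'$ of test points, the computation-aware posterior on $f(X')$ given $y$ is $$\tilde\mu_y=\int_{\mathbb R^d}\mathcal N\bigl(m_0(X')+k(X',X)v,\;k(X',X')-k(X',X)G^{-1}k(X,X')\bigr)\,\eta_{y-m_0(X)}(\mathrm dv).$$ **Theorem.** Suppose in addition that, with $\bar v=\bar v(y-m_0(X))$, $$\operatorname{Cov}(f(X'),\bar v)=k(X',X)\,G^{-1}\operatorname{Cov}(y,\bar v).$$ Then: 1. for every $y\in\mathbb R^d$, $\tilde\mu_y=\mathcal N(\tilde m,\tilde k)$ with $\tilde m=m_0(X')+k(X',X)\,\bar v(y-m_0(X))$ and $\tilde k=k(X',X')-k(X',X)\,D\,k(X,X')$;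 2. the computation-aware posterior $y\mapsto\tilde\mu_y$ is strongly calibrated for the original Gaussian process prior and the original data-generating model, i.e. for the truth $u=f(X')$ and the data $y=f(X)+\zeta$; 3. if the test points are distinct and, in case $\sigma=0$, none of them is a training point, then $\tilde k$ is positive definite and $\tilde k^{-1/2}(\tilde m-f(X'))\sim\mathcal N(0,I)$. -/

import Mathlib

open MeasureTheory ProbabilityTheory
open scoped MatrixOrder

noncomputable section

namespace CAGP

/-- The Euclidean space `ℝⁿ`. -/
abbrev Vec (n : ℕ) : Type := EuclideanSpace ℝ (Fin n)

/-- The product `A x` of a (possibly rectangular) matrix and a vector of Euclidean space. -/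
def app {m n : ℕ} (A : Matrix (Fin m) (Fin n) ℝ) (x : Vec n) : Vec m :=
  WithLp.toLp 2 (A.mulVec x.ofLp)

/-- The inverse square root `A^{-1/2}` of a positive definite matrix, the inverse of its unique
positive semidefinite square root. -/
def invSqrt {n : ℕ} (A : Matrix (Fin n) (Fin n) ℝ) : Matrix (Fin n) (Fin n) ℝ :=
  (CFC.sqrt A)⁻¹

/-- `μ` is the Gaussian distribution `N(m, S)`, where `S` is a genuine (symmetric positive
semidefinite, possibly singular) covariance matrix. -/
def IsGaussianDist {n : ℕ} (μ : Measure (Vec n)) (m : Vec n) (S : Matrix (Fin n) (Fin n) ℝ) :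
    Prop :=
  S.PosSemidef ∧ μ = multivariateGaussian m S

/-- The cross-covariance matrix `Cov(U, V)` of two random vectors. -/
def crossCov {Ω : Type*} [MeasurableSpace Ω] {m n : ℕ} (P : Measure Ω)
    (U : Ω → Vec m) (V : Ω → Vec n) : Matrix (Fin m) (Fin n) ℝ :=
  Matrix.of fun i j => cov[fun ω => U ω i, fun ω => V ω j; P]

/-! ### Gaussian process regression -/

section GP

variable {𝒳 : Type*}

/-- The matrix `k(A, B)` of kernel evaluations at two finite families of points. -/
def gram (k : 𝒳 → 𝒳 → ℝ) {m n : ℕ} (A : Fin m → 𝒳) (B : Fin n → 𝒳) :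
    Matrix (Fin m) (Fin n) ℝ :=
  Matrix.of fun i j => k (A i) (B j)

/-- Positive definite kernels: Gram matrices of distinct points are positive definite. -/
def IsPosDefKernel (k : 𝒳 → 𝒳 → ℝ) : Prop :=
  ∀ (n : ℕ) (x : Fin n → 𝒳), Function.Injective x → (gram k x x).PosDef

/-- `f ~ GP(m₀, k)` under the probability measure `P`. -/
structure IsGP {Ω : Type*} [MeasurableSpace Ω] (m₀ : 𝒳 → ℝ) (k : 𝒳 → 𝒳 → ℝ)
    (f : 𝒳 → Ω → ℝ) (P : Measure Ω) : Prop where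
  gaussian : IsGaussianProcess f P
  mean : ∀ t, ∫ ω, f t ω ∂P = m₀ t
  cov : ∀ s t, cov[f s, f t; P] = k s t

/-- The vector `g(A)` of values of a function at a finite family of points. -/
def evalAt (g : 𝒳 → ℝ) {n : ℕ} (A : Fin n → 𝒳) : Vec n :=
  WithLp.toLp 2 fun i => g (A i)

/-- `G = k(X, X) + σ² I`. -/
def gramNoise (k : 𝒳 → 𝒳 → ℝ) (σ : ℝ) {d : ℕ} (X : Fin d → 𝒳) : Matrix (Fin d) (Fin d) ℝ :=
  gram k X X + σ ^ 2 • 1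

/-- The inverse prior `N(0, G⁻¹)` on the solution of the linear system `G v = y - m₀(X)`. -/
def inversePrior (k : 𝒳 → 𝒳 → ℝ) (σ : ℝ) {d : ℕ} (X : Fin d → 𝒳) : Measure (Vec d) :=
  multivariateGaussian 0 (gramNoise k σ X)⁻¹

/-- The conditional belief `p(f(X') | v)` given the solution `v` of `G v = y - m₀(X)`:
the Gaussian with mean `m₀(X') + k(X', X) v` and covariance
`k(X', X') - k(X', X) G⁻¹ k(X, X')`. -/
def predictive (m₀ : 𝒳 → ℝ) (k : 𝒳 → 𝒳 → ℝ) (σ : ℝ) {d d' : ℕ} (X : Fin d → 𝒳)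
    (X' : Fin d' → 𝒳) (v : Vec d) : Measure (Vec d') :=
  multivariateGaussian (evalAt m₀ X' + app (gram k X' X) v)
    (gram k X' X' - gram k X' X * (gramNoise k σ X)⁻¹ * gram k X X')

end GP

/-! ### Learning procedures and strong calibration -/

/-- A learning procedure maps a prior on `U` and data in `Y` to a distribution on `U`. A
probabilistic linear solver on `ℝᵈ` is a learning procedure whose data are the right-hand sides. -/
abbrev LearningProcedure (U Y : Type*) [MeasurableSpace U] : Type _ :=
  Measure U → Y → Measure U

/-- The columns of `R` and of `N` are mutually orthonormal bases of the row space and of the null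
space of `S`. -/
structure IsRowNullBasis {n r s : ℕ} (S : Matrix (Fin n) (Fin n) ℝ)
    (R : Matrix (Fin n) (Fin r) ℝ) (N : Matrix (Fin n) (Fin s) ℝ) : Prop where
  row_orthonormal : R.transpose * R = 1
  null_orthonormal : N.transpose * N = 1
  mutually_orthogonal : R.transpose * N = 0
  row_span : Submodule.span ℝ (Set.range R.col) = Submodule.span ℝ (Set.range S.row)
  null_span : Submodule.span ℝ (Set.range N.col) = LinearMap.ker S.mulVecLin

/-- Strong calibration of a Gaussian learning procedure at a fixed prior. On the probability space
`(Ω, P)` the truth `u` is drawn from the prior and the data `y` are generated from it; `post`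
maps data to the distribution that the procedure returns. It is strongly calibrated if
`post z = N(ū(z), S)` with `S` independent of the data `z`, and, for orthonormal bases `R`, `N` of
the row and null spaces of `S`, `(Rᵀ S R)^{-1/2} Rᵀ (ū(y) - u) ~ N(0, I)` and `Nᵀ (ū(y) - u) = 0`
almost surely. -/
def StronglyCalibrated {Ω Y : Type*} [MeasurableSpace Ω] {n : ℕ} (P : Measure Ω)
    (u : Ω → Vec n) (y : Ω → Y) (post : Y → Measure (Vec n)) : Prop :=
  ∃ (ubar : Y → Vec n) (S : Matrix (Fin n) (Fin n) ℝ),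
    (∀ z, IsGaussianDist (post z) (ubar z) S) ∧
    ∀ (r s : ℕ) (R : Matrix (Fin n) (Fin r) ℝ) (N : Matrix (Fin n) (Fin s) ℝ),
      IsRowNullBasis S R N →
        HasLaw (fun ω => app (invSqrt (R.transpose * S * R) * R.transpose) (ubar (y ω) - u ω))
          (stdGaussian (Vec r)) P ∧
        ∀ᵐ ω ∂P, app N.transpose (ubar (y ω) - u ω) = 0

/-- A probabilistic linear solver `η` for a system with matrix `G` is strongly calibrated for
the prior `η₀`: the truth is `v ~ η₀`, and the data are the right-hand side `b = G v`. -/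
def CalibratedPLS {d : ℕ} (G : Matrix (Fin d) (Fin d) ℝ) (η₀ : Measure (Vec d))
    (η : LearningProcedure (Vec d) (Vec d)) : Prop :=
  StronglyCalibrated η₀ id (app G) (η η₀)

/-! ### Computation-aware Gaussian processes -/

section CAGP

variable {𝒳 : Type*}

/-- The computation-aware posterior on `f(X')` given the data `y`: the marginalisation
`∫ p(f(X') | v) η(dv)` of the belief `η` that the solver returns for the prior `N(0, G⁻¹)` and the
right-hand side `b = y - m₀(X)`. -/
def cagpPosterior (m₀ : 𝒳 → ℝ) (k : 𝒳 → 𝒳 → ℝ) (σ : ℝ) {d d' : ℕ} (X : Fin d → 𝒳)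
    (X' : Fin d' → 𝒳) (η : LearningProcedure (Vec d) (Vec d)) (y : Vec d) : Measure (Vec d') :=
  (η (inversePrior k σ X) (y - evalAt m₀ X)).bind (predictive m₀ k σ X X')

/-- `m̃(X') = m₀(X') + k(X', X) v̄`. -/
def cagpMean (m₀ : 𝒳 → ℝ) (k : 𝒳 → 𝒳 → ℝ) {d d' : ℕ} (X : Fin d → 𝒳) (X' : Fin d' → 𝒳)
    (v : Vec d) : Vec d' :=
  evalAt m₀ X' + app (gram k X' X) v

/-- `k̃(X', X') = k(X', X') - k(X', X) D k(X, X')`. -/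
def cagpCov (k : 𝒳 → 𝒳 → ℝ) {d d' : ℕ} (X : Fin d → 𝒳) (X' : Fin d' → 𝒳)
    (D : Matrix (Fin d) (Fin d) ℝ) : Matrix (Fin d') (Fin d') ℝ :=
  gram k X' X' - gram k X' X * D * gram k X X'

end CAGP

end CAGP

end

/-! A Gaussian belief with covariance `S` is strongly calibrated exactly when its error has the law
`N(0, S)` (`calibrated_iff_hasLaw`): the two conditions whiten the error on the row space of `S` and
kill it on the null space. This turns the solver's calibration into a law that can be used, and
reduces calibration of the posterior to the law of `m̃ - f(X')`.

Write `K = k(X', X)` and `v = G⁻¹ (y - m₀(X))`. Since `y ~ N(m₀(X), G)`, the weights `v` have law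
`N(0, G⁻¹)`, and `G v` is the right-hand side that the solver sees; hence `v̄ - v ~ N(0, G⁻¹ - D)`.
The error is `K (v̄ - v) - r`, with `r = f(X') - m₀(X') - K v` the regression residual. This
residual is uncorrelated with `y`, so by joint Gaussianity independent of it
(`residual_indep_and_law`), and hence of `v̄ - v`, which depends on `y` alone. Its covariance is the
Schur complement `T = k(X', X') - K G⁻¹ k(X, X')`. The two covariances add up to `K (G⁻¹ - D) Kᵀ + T
= k̃` (`hasLaw_error`, `cagpCov_eq`).

Marginalising the conditional belief over the solver's output adds the same two covariances
(`bind_multivariateGaussian`). Definiteness of `k̃` comes from that of `T` (`schur_posDef`). -/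

noncomputable section

namespace CAGP

/-! ### Matrices acting on Euclidean space -/

section App

variable {l m n : ℕ}

lemma app_ofLp (A : Matrix (Fin m) (Fin n) ℝ) (x : Vec n) : (app A x).ofLp = A.mulVec x.ofLp := rfl

lemma app_add (A : Matrix (Fin m) (Fin n) ℝ) (x y : Vec n) : app A (x + y) = app A x + app A y := by
  simp [app, Matrix.mulVec_add]

lemma app_sub (A : Matrix (Fin m) (Fin n) ℝ) (x y : Vec n) : app A (x - y) = app A x - app A y := by
  simp [app, Matrix.mulVec_sub]

lemma app_zero (A : Matrix (Fin m) (Fin n) ℝ) : app A 0 = 0 := by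
  simp [app]

lemma app_app (A : Matrix (Fin l) (Fin m) ℝ) (B : Matrix (Fin m) (Fin n) ℝ) (x : Vec n) :
    app A (app B x) = app (A * B) x := by
  simp [app, Matrix.mulVec_mulVec]

lemma app_one (x : Vec n) : app 1 x = x := by
  simp [app]

lemma app_add_left (A B : Matrix (Fin m) (Fin n) ℝ) (x : Vec n) :
    app (A + B) x = app A x + app B x := by
  simp [app, Matrix.add_mulVec]

/-- Multiplication by a matrix, as a continuous linear map between Euclidean spaces. -/
def appCLM (A : Matrix (Fin m) (Fin n) ℝ) : Vec n →L[ℝ] Vec m :=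
  LinearMap.toContinuousLinearMap
    { toFun := app A
      map_add' := app_add A
      map_smul' := fun c x => by simp [app, Matrix.mulVec_smul] }

@[fun_prop]
lemma continuous_app (A : Matrix (Fin m) (Fin n) ℝ) : Continuous (app A) :=
  (appCLM A).continuous

@[fun_prop]
lemma measurable_app (A : Matrix (Fin m) (Fin n) ℝ) : Measurable (app A) :=
  (continuous_app A).measurable

lemma inner_app (A : Matrix (Fin m) (Fin n) ℝ) (t : Vec m) (x : Vec n) :
    inner ℝ t (app A x) = inner ℝ (app A.transpose t) x := by
  simp only [EuclideanSpace.inner_eq_star_dotProduct, app_ofLp, star_trivial]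
  rw [Matrix.mulVec_transpose, dotProduct_comm, Matrix.dotProduct_mulVec, dotProduct_comm]

end App

/-! ### Gaussian vectors: affine images, sums, marginalisation -/

section Gaussian

variable {Ω : Type*} [MeasurableSpace Ω] {P : Measure Ω} {m n : ℕ}

lemma posSemidef_conj {S : Matrix (Fin n) (Fin n) ℝ} (hS : S.PosSemidef)
    (A : Matrix (Fin m) (Fin n) ℝ) : (A * S * A.transpose).PosSemidef := by
  simpa [Matrix.conjTranspose_eq_transpose_of_trivial] using hS.mul_mul_conjTranspose_same A

/-- An affine image of a Gaussian vector is Gaussian. -/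
lemma hasLaw_affine {U : Ω → Vec n} {c : Vec n} {S : Matrix (Fin n) (Fin n) ℝ}
    (hS : S.PosSemidef) (hU : HasLaw U (multivariateGaussian c S) P)
    (a : Vec m) (A : Matrix (Fin m) (Fin n) ℝ) :
    HasLaw (fun ω => a + app A (U ω))
      (multivariateGaussian (a + app A c) (A * S * A.transpose)) P := by
  have hg : Measurable fun x : Vec n => a + app A x := by fun_prop
  refine HasLaw.fun_comp (Y := fun x => a + app A x) ⟨hg.aemeasurable, ?_⟩ hU
  have : IsProbabilityMeasure ((multivariateGaussian c S).map fun x => a + app A x) :=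
    Measure.isProbabilityMeasure_map hg.aemeasurable
  refine Measure.ext_of_charFun ?_
  ext t
  have h1 : charFun ((multivariateGaussian c S).map fun x => a + app A x) t
      = charFun (multivariateGaussian c S) (app A.transpose t)
        * Complex.exp (inner ℝ t a * Complex.I) := by
    rw [charFun_apply, integral_map hg.aemeasurable (by fun_prop), charFun_apply,
      ← integral_mul_const]
    refine integral_congr_ae (.of_forall fun x => ?_)
    simp only
    rw [← Complex.exp_add, real_inner_comm, inner_add_right, inner_app,
      real_inner_comm x]
    push_cast
    ring_nf
  rw [h1, charFun_multivariateGaussian hS, charFun_multivariateGaussian (posSemidef_conj hS A),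
    ← Complex.exp_add, inner_add_right, inner_app]
  have h2 : t.ofLp ⬝ᵥ (A * S * A.transpose).mulVec t.ofLp
      = (app A.transpose t).ofLp ⬝ᵥ S.mulVec (app A.transpose t).ofLp := by
    rw [app_ofLp, ← Matrix.mulVec_mulVec, ← Matrix.mulVec_mulVec, Matrix.dotProduct_mulVec t.ofLp,
      Matrix.mulVec_transpose]
  rw [h2]
  push_cast
  ring_nf

lemma hasLaw_app {U : Ω → Vec n} {S : Matrix (Fin n) (Fin n) ℝ}
    (hS : S.PosSemidef) (hU : HasLaw U (multivariateGaussian 0 S) P)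
    (A : Matrix (Fin m) (Fin n) ℝ) :
    HasLaw (fun ω => app A (U ω)) (multivariateGaussian 0 (A * S * A.transpose)) P := by
  simpa [app_zero] using hasLaw_affine hS hU 0 A

/-- The sum of two independent Gaussian vectors is Gaussian. -/
lemma hasLaw_add {U V : Ω → Vec n} {a b : Vec n} {S T : Matrix (Fin n) (Fin n) ℝ}
    (hS : S.PosSemidef) (hT : T.PosSemidef) (hU : HasLaw U (multivariateGaussian a S) P)
    (hV : HasLaw V (multivariateGaussian b T) P) (hUV : IndepFun U V P) :
    HasLaw (fun ω => U ω + V ω) (multivariateGaussian (a + b) (S + T)) P := by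
  convert IndepFun.hasLaw_fun_add hU hV hUV using 1
  refine Measure.ext_of_charFun ?_
  ext t
  rw [charFun_conv, charFun_multivariateGaussian hS, charFun_multivariateGaussian hT,
    charFun_multivariateGaussian (hS.add hT), ← Complex.exp_add, inner_add_right,
    Matrix.add_mulVec, dotProduct_add]
  push_cast
  ring_nf

/-- A Gaussian vector is determined by its mean and its covariance matrix. -/
lemma hasLaw_multivariateGaussian {U : Ω → Vec n} (hU : HasGaussianLaw U P) {a : Vec n}
    {S : Matrix (Fin n) (Fin n) ℝ} (hS : S.PosSemidef) (hmean : ∀ i, ∫ ω, U ω i ∂P = a i)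
    (hcov : ∀ i j, cov[fun ω => U ω i, fun ω => U ω j; P] = S i j) :
    HasLaw U (multivariateGaussian a S) P := by
  have := hU.isProbabilityMeasure
  have hUi : ∀ i, MemLp (fun ω => U ω i) 2 P := fun i =>
    (hU.map_fun (EuclideanSpace.proj i)).memLp_two
  refine ⟨hU.aemeasurable, Measure.ext_of_charFun ?_⟩
  ext t
  have hinner : ∀ ω, inner ℝ t (U ω) = ∑ i, t i * U ω i := fun ω => by
    simp [PiLp.inner_apply, mul_comm]
  rw [hU.charFun_map_eq, charFun_multivariateGaussian hS]
  simp_rw [hinner]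
  rw [integral_finsetSum _ fun i _ => ((hUi i).integrable (by norm_num)).const_mul _,
    ← covariance_self (Finset.aemeasurable_fun_sum _ fun i _ =>
      ((hUi i).const_mul (t i)).aemeasurable),
    covariance_fun_sum_fun_sum (fun i => (hUi i).const_mul (t i)) fun i => (hUi i).const_mul (t i)]
  simp_rw [integral_const_mul, hmean, covariance_const_mul_left, covariance_const_mul_right, hcov]
  have h1 : inner ℝ t a = ∑ i, t i * a i := by simp [PiLp.inner_apply, mul_comm]
  have h2 : t.ofLp ⬝ᵥ S.mulVec t.ofLp = ∑ i, ∑ j, t i * (t j * S i j) := by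
    simp only [dotProduct, Matrix.mulVec, Finset.mul_sum]
    exact Finset.sum_congr rfl fun i _ => Finset.sum_congr rfl fun j _ => by ring
  rw [h1, h2]

/-- Mean and covariance can be read off the measure. This identifies the parameters hidden behind
the existential quantifier in `StronglyCalibrated` with given ones. -/
lemma multivariateGaussian_inj {a b : Vec n} {S T : Matrix (Fin n) (Fin n) ℝ}
    (hS : S.PosSemidef) (hT : T.PosSemidef)
    (h : multivariateGaussian a S = multivariateGaussian b T) : a = b ∧ S = T := by
  constructor
  · rw [← integral_id_multivariateGaussian (μ := a) (S := S), h, integral_id_multivariateGaussian]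
  · ext i j
    rw [← covariance_eval_multivariateGaussian (μ := a) hS, h,
      covariance_eval_multivariateGaussian hT]

/-- The Gaussian marginal of a Gaussian prior and an affine Gaussian conditional. -/
lemma bind_multivariateGaussian {c : Vec n} {S : Matrix (Fin n) (Fin n) ℝ} (hS : S.PosSemidef)
    {T : Matrix (Fin m) (Fin m) ℝ} (hT : T.PosSemidef) (a : Vec m)
    (K : Matrix (Fin m) (Fin n) ℝ) :
    (multivariateGaussian c S).bind (fun v => multivariateGaussian (a + app K v) T) =
      multivariateGaussian (a + app K c) (K * S * K.transpose + T) := by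
  set μ := multivariateGaussian c S
  set ν := multivariateGaussian (0 : Vec m) T
  -- The mixture is the law of `a + K v + w` with `v ~ N(c, S)` and `w ~ N(0, T)` independent,
  -- realised on the product space.
  have hfst : HasLaw (Prod.fst : Vec n × Vec m → Vec n) μ (μ.prod ν) :=
    measurePreserving_fst.hasLaw
  have hsnd : HasLaw (Prod.snd : Vec n × Vec m → Vec m) ν (μ.prod ν) :=
    measurePreserving_snd.hasLaw
  have hsum := hasLaw_add (posSemidef_conj hS K) hT (hasLaw_affine hS hfst a K) hsnd
    (indepFun_prod (X := fun v : Vec n => a + app K v) (Y := fun w : Vec m => w)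
      (by fun_prop) measurable_id)
  rw [add_zero] at hsum
  have hg : Measurable fun p : Vec n × Vec m => a + app K p.1 + p.2 := by fun_prop
  rw [← hsum.map_eq]
  have hpred : ∀ v, multivariateGaussian (a + app K v) T = ν.map fun w => a + app K v + w :=
    fun v => by
      have := (hasLaw_affine hT (HasLaw.id (μ := ν)) (a + app K v) 1).map_eq
      simpa [app_one] using this.symm
  simp_rw [hpred]
  have hmeas : Measurable fun v : Vec n => ν.map fun w => a + app K v + w := by
    refine Measure.measurable_of_measurable_coe _ fun s hs => ?_
    have hcoe : (fun v : Vec n => (ν.map fun w => a + app K v + w) s) = fun v : Vec n =>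
        ν (Prod.mk v ⁻¹' ((fun p : Vec n × Vec m => a + app K p.1 + p.2) ⁻¹' s)) :=
      funext fun v => Measure.map_apply (by fun_prop) hs
    rw [hcoe]
    exact measurable_measure_prodMk_left (hg hs)
  ext s hs
  rw [Measure.bind_apply hs hmeas.aemeasurable, Measure.map_apply hg hs,
    Measure.prod_apply (hg hs)]
  refine lintegral_congr fun v => ?_
  rw [Measure.map_apply (by fun_prop) hs]
  rfl

end Gaussian

/-! ### Orthonormal bases of the row and null spaces -/

section RowNull

variable {n r s : ℕ}

lemma exists_orthonormal_columns (V : Submodule ℝ (Fin n → ℝ)) :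
    ∃ (r : ℕ) (R : Matrix (Fin n) (Fin r) ℝ), R.transpose * R = 1 ∧
      Submodule.span ℝ (Set.range R.col) = V := by
  set e : Vec n ≃ₗ[ℝ] (Fin n → ℝ) := WithLp.linearEquiv 2 ℝ (Fin n → ℝ)
  set W : Submodule ℝ (Vec n) := V.comap e.toLinearMap
  set b := stdOrthonormalBasis ℝ W
  refine ⟨Module.finrank ℝ W, Matrix.of fun i j => (b j : Vec n) i, ?_, ?_⟩
  · ext i j
    have h := orthonormal_iff_ite.1 b.orthonormal i j
    rw [Submodule.coe_inner, PiLp.inner_apply] at h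
    rw [Matrix.one_apply, ← h, Matrix.mul_apply]
    refine Finset.sum_congr rfl fun l _ => ?_
    simp only [Matrix.transpose_apply, Matrix.of_apply, RCLike.inner_apply, conj_trivial]
    ring
  · have hcol : Set.range (Matrix.of fun i j => (b j : Vec n) i).col =
        e '' (W.subtype '' Set.range b) := by
      rw [← Set.range_comp, ← Set.range_comp]
      rfl
    have hb : Submodule.span ℝ (Set.range b) = ⊤ := by
      simpa using b.toBasis.span_eq
    rw [hcol]
    erw [Submodule.span_image e.toLinearMap]
    rw [Submodule.span_image, hb, Submodule.map_top, Submodule.range_subtype]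
    exact Submodule.map_comap_eq_of_surjective e.surjective V

/-- Strong calibration quantifies over all such bases, so as a hypothesis it yields something only
once a basis exists. Orthogonality is automatic: a null vector is annihilated by every row, hence by
their span. -/
lemma exists_isRowNullBasis (S : Matrix (Fin n) (Fin n) ℝ) :
    ∃ (r s : ℕ) (R : Matrix (Fin n) (Fin r) ℝ) (N : Matrix (Fin n) (Fin s) ℝ),
      IsRowNullBasis S R N := by
  obtain ⟨r, R, hR, hRs⟩ := exists_orthonormal_columns (Submodule.span ℝ (Set.range S.row))
  obtain ⟨s, N, hN, hNs⟩ := exists_orthonormal_columns (LinearMap.ker S.mulVecLin)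
  refine ⟨r, s, R, N, hR, hN, ?_, hRs, hNs⟩
  ext i j
  have hNj : S.mulVec (N.col j) = 0 := by
    have : N.col j ∈ LinearMap.ker S.mulVecLin :=
      hNs ▸ Submodule.subset_span (Set.mem_range_self j)
    simpa using this
  have hRi : R.col i ∈ Submodule.span ℝ (Set.range S.row) :=
    hRs ▸ Submodule.subset_span (Set.mem_range_self i)
  change R.col i ⬝ᵥ N.col j = 0
  generalize R.col i = x at hRi
  induction hRi using Submodule.span_induction with
  | mem x hx =>
    obtain ⟨l, rfl⟩ := hx
    exact congrFun hNj l
  | zero => simp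
  | add x y _ _ hx hy => rw [add_dotProduct, hx, hy, add_zero]
  | smul c x _ hx => rw [smul_dotProduct, hx, smul_zero]

namespace IsRowNullBasis

variable {S : Matrix (Fin n) (Fin n) ℝ} {R : Matrix (Fin n) (Fin r) ℝ}
  {N : Matrix (Fin n) (Fin s) ℝ}

lemma exists_eq_mulVec_of_mulVec_eq_zero (h : IsRowNullBasis S R N) {x : Fin n → ℝ}
    (hx : S.mulVec x = 0) : ∃ c, N.mulVec c = x := by
  have : x ∈ LinearMap.range N.mulVecLin := by
    rw [Matrix.range_mulVecLin, h.null_span]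
    simpa using hx
  simpa using this

lemma mul_null (h : IsRowNullBasis S R N) : S * N = 0 := by
  ext i j
  have : N.col j ∈ LinearMap.ker S.mulVecLin :=
    h.null_span ▸ Submodule.subset_span (Set.mem_range_self j)
  have h0 : S.mulVec (N.col j) = 0 := by simpa using this
  exact congrFun h0 i

lemma mulVec_eq_zero_of_transpose (h : IsRowNullBasis S R N) {x : Fin n → ℝ}
    (hx : R.transpose.mulVec x = 0) : S.mulVec x = 0 := by
  ext i
  have hi : S.row i ∈ LinearMap.range R.mulVecLin := by
    rw [Matrix.range_mulVecLin, h.row_span]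
    exact Submodule.subset_span (Set.mem_range_self i)
  obtain ⟨c, hc⟩ := hi
  change S.row i ⬝ᵥ x = 0
  rw [← hc, Matrix.mulVecLin_apply, ← Matrix.vecMul_transpose, ← Matrix.dotProduct_mulVec, hx,
    dotProduct_zero]

/-- The defect `Q` of the two projections satisfies `Rᵀ Q = 0` and `Nᵀ Q = 0`. By the first its
columns lie in the null space, the range of `N`; by the second they vanish. -/
lemma row_add_null (h : IsRowNullBasis S R N) :
    R * R.transpose + N * N.transpose = 1 := by
  have hNR : N.transpose * R = 0 := by
    rw [← Matrix.transpose_transpose (N.transpose * R), Matrix.transpose_mul,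
      Matrix.transpose_transpose, h.mutually_orthogonal, Matrix.transpose_zero]
  set Q := 1 - (R * R.transpose + N * N.transpose) with hQ
  have hRQ : R.transpose * Q = 0 := by
    rw [hQ, Matrix.mul_sub, Matrix.mul_add, ← Matrix.mul_assoc, ← Matrix.mul_assoc, h.row_orthonormal, h.mutually_orthogonal]
    simp
  have hNQ : N.transpose * Q = 0 := by
    rw [hQ, Matrix.mul_sub, Matrix.mul_add, ← Matrix.mul_assoc, ← Matrix.mul_assoc, h.null_orthonormal, hNR]
    simp
  have hQ0 : Q = 0 := by
    refine Matrix.ext_of_mulVec_single fun j => ?_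
    set z := Q.mulVec (Pi.single j 1)
    have hRz : R.transpose.mulVec z = 0 := by
      rw [Matrix.mulVec_mulVec, hRQ, Matrix.zero_mulVec]
    have hNz : N.transpose.mulVec z = 0 := by
      rw [Matrix.mulVec_mulVec, hNQ, Matrix.zero_mulVec]
    obtain ⟨c, hc⟩ := h.exists_eq_mulVec_of_mulVec_eq_zero (h.mulVec_eq_zero_of_transpose hRz)
    have hc0 : c = 0 := by
      rw [← hc, Matrix.mulVec_mulVec, h.null_orthonormal, Matrix.one_mulVec] at hNz
      exact hNz
    rw [← hc, hc0, Matrix.mulVec_zero, Matrix.zero_mulVec]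
  exact (sub_eq_zero.1 hQ0).symm

lemma mul_row_row (h : IsRowNullBasis S R N) : S * (R * R.transpose) = S := by
  rw [eq_sub_of_add_eq h.row_add_null, Matrix.mul_sub, ← Matrix.mul_assoc, h.mul_null]
  simp

lemma row_row_mul (h : IsRowNullBasis S R N) (hS : S.PosSemidef) :
    R * R.transpose * S = S := by
  have hSt : S.transpose = S := hS.isHermitian
  have := congrArg Matrix.transpose h.mul_row_row
  simpa [Matrix.transpose_mul, hSt] using this

/-- If `Rᵀ S R x = 0`, then `S R x = R Rᵀ S R x = 0`, so `R x` lies in the range of `N`, which is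
orthogonal to `R`; hence `x = Rᵀ R x = 0`. -/
lemma posDef_compression (h : IsRowNullBasis S R N) (hS : S.PosSemidef) :
    (R.transpose * S * R).PosDef := by
  have hpsd : (R.transpose * S * R).PosSemidef := by
    simpa using posSemidef_conj hS R.transpose
  refine .of_dotProduct_mulVec_pos hpsd.isHermitian fun x hx => ?_
  refine (hpsd.dotProduct_mulVec_nonneg x).lt_of_ne fun h0 => hx ?_
  have hx0 : (R.transpose * S * R).mulVec x = 0 := (hpsd.dotProduct_mulVec_zero_iff x).1 h0.symm
  have hRR : S * R = R * (R.transpose * S * R) := by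
    rw [← Matrix.mul_assoc, ← Matrix.mul_assoc, h.row_row_mul hS]
  have hSR : S.mulVec (R.mulVec x) = 0 := by
    rw [Matrix.mulVec_mulVec, hRR, ← Matrix.mulVec_mulVec, hx0, Matrix.mulVec_zero]
  obtain ⟨c, hc⟩ := h.exists_eq_mulVec_of_mulVec_eq_zero hSR
  calc x = (R.transpose * R).mulVec x := by rw [h.row_orthonormal, Matrix.one_mulVec]
    _ = 0 := by
      rw [← Matrix.mulVec_mulVec, ← hc, Matrix.mulVec_mulVec, h.mutually_orthogonal,
        Matrix.zero_mulVec]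

end IsRowNullBasis

end RowNull

/-! ### The inverse square root -/

section InvSqrt

variable {n : ℕ} {A : Matrix (Fin n) (Fin n) ℝ}

lemma transpose_sqrt (A : Matrix (Fin n) (Fin n) ℝ) :
    (CFC.sqrt A).transpose = CFC.sqrt A :=
  (Matrix.nonneg_iff_posSemidef.1 (CFC.sqrt_nonneg A)).isHermitian

lemma isUnit_sqrt (hA : A.PosDef) : IsUnit (CFC.sqrt A).det := by
  have h := congrArg Matrix.det (CFC.sqrt_mul_sqrt_self A hA.posSemidef.nonneg)
  rw [Matrix.det_mul] at h
  exact isUnit_of_mul_isUnit_left (h ▸ (Matrix.isUnit_iff_isUnit_det _).1 hA.isUnit)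

lemma sqrt_mul_invSqrt (hA : A.PosDef) : CFC.sqrt A * invSqrt A = 1 :=
  Matrix.mul_nonsing_inv _ (isUnit_sqrt hA)

lemma invSqrt_mul_sqrt (hA : A.PosDef) : invSqrt A * CFC.sqrt A = 1 :=
  Matrix.nonsing_inv_mul _ (isUnit_sqrt hA)

lemma transpose_invSqrt (A : Matrix (Fin n) (Fin n) ℝ) : (invSqrt A).transpose = invSqrt A := by
  rw [invSqrt, Matrix.transpose_nonsing_inv, transpose_sqrt]

lemma invSqrt_mul_self_mul_invSqrt (hA : A.PosDef) : invSqrt A * A * invSqrt A = 1 := by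
  have h := CFC.sqrt_mul_sqrt_self A hA.posSemidef.nonneg
  calc invSqrt A * A * invSqrt A
      = (invSqrt A * CFC.sqrt A) * (CFC.sqrt A * invSqrt A) := by
        nth_rw 2 [← h]
        simp only [mul_assoc]
    _ = 1 := by rw [invSqrt_mul_sqrt hA, sqrt_mul_invSqrt hA, mul_one]

end InvSqrt

/-! ### Strong calibration as a statement on the law of the error -/

section Calibration

variable {Ω : Type*} [MeasurableSpace Ω] {P : Measure Ω} {n : ℕ}

/-- Whitening of a nondegenerate centred Gaussian vector. -/
lemma hasLaw_invSqrt {w : Ω → Vec n} {S : Matrix (Fin n) (Fin n) ℝ} (hS : S.PosDef)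
    (hw : HasLaw w (multivariateGaussian 0 S) P) :
    HasLaw (fun ω => app (invSqrt S) (w ω)) (stdGaussian (Vec n)) P := by
  have h := hasLaw_app hS.posSemidef hw (invSqrt S)
  rwa [transpose_invSqrt, invSqrt_mul_self_mul_invSqrt hS, multivariateGaussian_zero_one] at h

/-- The error `w` of a Gaussian belief with covariance `S` satisfies the two conditions of strong
calibration if and only if it has the law `N(0, S)`. -/
lemma calibrated_iff_hasLaw {r s : ℕ} {w : Ω → Vec n} {S : Matrix (Fin n) (Fin n) ℝ}
    {R : Matrix (Fin n) (Fin r) ℝ} {N : Matrix (Fin n) (Fin s) ℝ} (hS : S.PosSemidef)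
    (h : IsRowNullBasis S R N) :
    (HasLaw (fun ω => app (invSqrt (R.transpose * S * R) * R.transpose) (w ω))
        (stdGaussian (Vec r)) P ∧ ∀ᵐ ω ∂P, app N.transpose (w ω) = 0) ↔
      HasLaw w (multivariateGaussian 0 S) P := by
  have hA := h.posDef_compression hS
  set A := R.transpose * S * R with hAdef
  constructor
  · rintro ⟨hZ, hN⟩
    rw [← multivariateGaussian_zero_one] at hZ
    obtain ⟨Q, hQt, hQQ, hQi⟩ : ∃ Q : Matrix (Fin r) (Fin r) ℝ,
        Q.transpose = Q ∧ Q * Q = A ∧ Q * invSqrt A = 1 :=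
      ⟨CFC.sqrt A, transpose_sqrt A, CFC.sqrt_mul_sqrt_self A hA.posSemidef.nonneg,
        sqrt_mul_invSqrt hA⟩
    -- With `Q = A^{1/2}`, the matrix `R Q` undoes the whitening: it sends `N(0, I)` to `N(0, R A
    -- Rᵀ) = N(0, S)`, and the whitened error to `R Rᵀ w`, which is `w` because `Nᵀ w = 0`.
    have hlaw := hasLaw_app Matrix.PosSemidef.one hZ (R * Q)
    have hcov : R * Q * (1 : Matrix (Fin r) (Fin r) ℝ) * (R * Q).transpose = S := by
      calc R * Q * (1 : Matrix (Fin r) (Fin r) ℝ) * (R * Q).transpose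
          = R * (Q * Q) * R.transpose := by
            rw [Matrix.transpose_mul, hQt, Matrix.mul_one]
            simp only [Matrix.mul_assoc]
        _ = (R * R.transpose * S) * (R * R.transpose) := by
            rw [hQQ, hAdef]
            simp only [Matrix.mul_assoc]
        _ = S := by rw [h.row_row_mul hS, h.mul_row_row]
    rw [hcov] at hlaw
    refine hlaw.congr ?_
    filter_upwards [hN] with ω hω
    have hmat : R * Q * (invSqrt A * R.transpose) = R * R.transpose := by
      rw [Matrix.mul_assoc, ← Matrix.mul_assoc Q, hQi, Matrix.one_mul]
    rw [app_app, hmat]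
    conv_lhs => rw [← app_one (w ω), ← h.row_add_null, app_add_left, ← app_app N, hω, app_zero,
      add_zero]
  · intro hw
    constructor
    · have hlaw := hasLaw_app hS hw (invSqrt A * R.transpose)
      have hcov : invSqrt A * R.transpose * S * (invSqrt A * R.transpose).transpose = 1 := by
        rw [Matrix.transpose_mul, transpose_invSqrt, Matrix.transpose_transpose]
        calc invSqrt A * R.transpose * S * (R * invSqrt A)
            = invSqrt A * (R.transpose * S * R) * invSqrt A := by
              simp only [hAdef, Matrix.mul_assoc]
          _ = 1 := invSqrt_mul_self_mul_invSqrt hA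
      rwa [hcov, multivariateGaussian_zero_one] at hlaw
    -- The covariance `Nᵀ S N` vanishes, so the law of `Nᵀ w` is the Dirac mass at `0`.
    · have hlaw := hasLaw_app hS hw N.transpose
      rw [Matrix.transpose_transpose, Matrix.mul_assoc, h.mul_null, Matrix.mul_zero] at hlaw
      refine HasLaw.ae_eq_of_dirac (x := (0 : Vec s)) ?_
      simpa [multivariateGaussian] using hlaw

lemma stronglyCalibrated_of_hasLaw {Y : Type*} {u : Ω → Vec n} {y : Ω → Y}
    {post : Y → Measure (Vec n)} {ubar : Y → Vec n} {S : Matrix (Fin n) (Fin n) ℝ}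
    (hpost : ∀ z, IsGaussianDist (post z) (ubar z) S)
    (hS : S.PosSemidef)
    (herr : HasLaw (fun ω => ubar (y ω) - u ω) (multivariateGaussian 0 S) P) :
    StronglyCalibrated P u y post :=
  ⟨ubar, S, hpost, fun _ _ _ _ h => (calibrated_iff_hasLaw hS h).2 herr⟩

lemma StronglyCalibrated.hasLaw {Y : Type*} [Nonempty Y] {u : Ω → Vec n} {y : Ω → Y}
    {post : Y → Measure (Vec n)} {ubar : Y → Vec n} {S : Matrix (Fin n) (Fin n) ℝ}
    (hpost : ∀ z, IsGaussianDist (post z) (ubar z) S) (hcal : StronglyCalibrated P u y post) :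
    HasLaw (fun ω => ubar (y ω) - u ω) (multivariateGaussian 0 S) P := by
  obtain ⟨ubar', S', hpost', hbasis⟩ := hcal
  have heq : ∀ z, ubar z = ubar' z ∧ S = S' := fun z =>
    multivariateGaussian_inj (hpost z).1 (hpost' z).1 ((hpost z).2.symm.trans (hpost' z).2)
  obtain rfl : ubar = ubar' := funext fun z => (heq z).1
  obtain rfl : S = S' := (heq (Classical.arbitrary Y)).2
  obtain ⟨r, s, R, N, h⟩ := exists_isRowNullBasis S
  exact (calibrated_iff_hasLaw (hpost (Classical.arbitrary Y)).1 h).1 (hbasis r s R N h)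

end Calibration

/-! ### Gram matrices and their Schur complements -/

section Kernel

variable {𝒳 : Type*} {k : 𝒳 → 𝒳 → ℝ}

lemma IsPosDefKernel.posDef (hk : IsPosDefKernel k) {ι : Type*} [Fintype ι] {p : ι → 𝒳}
    (hp : Function.Injective p) : (Matrix.of fun i j => k (p i) (p j)).PosDef := by
  set e := Fintype.equivFin ι
  have h := (hk _ (p ∘ e.symm) (hp.comp e.symm.injective)).submatrix e.injective
  convert h using 1
  ext i j
  simp [gram]

/-- Points may repeat here: the matrix is pulled back, along a possibly non-injective reindexing,
from the Gram matrix of the distinct values. -/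
lemma IsPosDefKernel.posSemidef (hk : IsPosDefKernel k) {ι : Type*} [Fintype ι] (p : ι → 𝒳) :
    (Matrix.of fun i j => k (p i) (p j)).PosSemidef := by
  classical
  have : Fintype (Set.range p) := Fintype.ofFinite _
  exact (hk.posDef (p := ((↑) : Set.range p → 𝒳)) Subtype.val_injective).posSemidef.submatrix
    (Set.rangeFactorization p)

lemma IsPosDefKernel.symm (hk : IsPosDefKernel k) (s t : 𝒳) : k s t = k t s := by
  simpa using (hk.posSemidef ![t, s]).isHermitian.apply 0 1

lemma gram_transpose (hk : IsPosDefKernel k) {m n : ℕ} (A : Fin m → 𝒳) (B : Fin n → 𝒳) :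
    (gram k A B).transpose = gram k B A := by
  ext i j
  exact hk.symm _ _

lemma posSemidef_smul_one (σ : ℝ) (d : ℕ) :
    (σ ^ 2 • (1 : Matrix (Fin d) (Fin d) ℝ)).PosSemidef :=
  Matrix.PosSemidef.one.smul (sq_nonneg σ)

lemma gramNoise_posDef (hk : IsPosDefKernel k) (σ : ℝ) {d : ℕ} {X : Fin d → 𝒳}
    (hX : Function.Injective X) : (gramNoise k σ X).PosDef :=
  (hk d X hX).add_posSemidef (posSemidef_smul_one σ d)

/-- The covariance `k(X', X') - k(X', X) G⁻¹ k(X, X')` of the conditional belief. -/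
def schur (k : 𝒳 → 𝒳 → ℝ) (σ : ℝ) {d d' : ℕ} (X : Fin d → 𝒳) (X' : Fin d' → 𝒳) :
    Matrix (Fin d') (Fin d') ℝ :=
  gram k X' X' - gram k X' X * (gramNoise k σ X)⁻¹ * gram k X X'

variable {d d' : ℕ} {X : Fin d → 𝒳}

/-- Completing the square: at `z = -G⁻¹ k(X, X') x` the quadratic form of the block matrix with
lower right block `G` equals that of its Schur complement. Splitting off `σ² I` from `G` leaves the
Gram form of the joint family of points. -/
lemma schur_quadratic (hk : IsPosDefKernel k) (σ : ℝ) (hX : Function.Injective X)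
    (X' : Fin d' → 𝒳) (x : Fin d' → ℝ) :
    ∃ z : Fin d → ℝ, x ⬝ᵥ (schur k σ X X').mulVec x =
      Sum.elim x z ⬝ᵥ (Matrix.of fun i j => k (Sum.elim X' X i) (Sum.elim X' X j)).mulVec
        (Sum.elim x z) + σ ^ 2 * (z ⬝ᵥ z) := by
  have hG := gramNoise_posDef hk σ hX
  have : Invertible (gramNoise k σ X) := hG.isUnit.invertible
  set z := -((gramNoise k σ X)⁻¹ * (gram k X' X).conjTranspose).mulVec x
  have hz := Matrix.schur_complement_eq₂₂ (gram k X' X') (gram k X' X) x z hG.isHermitian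
  have hBt : (gram k X' X).conjTranspose = gram k X X' := by
    rw [Matrix.conjTranspose_eq_transpose_of_trivial, gram_transpose hk]
  have h0 : ((gramNoise k σ X)⁻¹ * (gram k X' X).conjTranspose).mulVec x + z = 0 :=
    add_neg_cancel _
  rw [h0, hBt] at hz
  refine ⟨z, ?_⟩
  simp only [star_trivial, Matrix.zero_vecMul, zero_dotProduct, zero_add,
    ← Matrix.dotProduct_mulVec] at hz
  rw [schur, ← hz]
  have hM : (Matrix.of fun i j => k (Sum.elim X' X i) (Sum.elim X' X j)) =
      Matrix.fromBlocks (gram k X' X') (gram k X' X) (gram k X X') (gram k X X) := by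
    ext (i | i) (j | j) <;> rfl
  rw [hM, Matrix.fromBlocks_mulVec, Matrix.fromBlocks_mulVec, sumElim_dotProduct_sumElim,
    sumElim_dotProduct_sumElim]
  simp only [Sum.elim_comp_inl, Sum.elim_comp_inr, gramNoise, Matrix.add_mulVec, dotProduct_add,
    Matrix.smul_mulVec, Matrix.one_mulVec, dotProduct_smul, smul_eq_mul]
  ring

lemma schur_isHermitian (hk : IsPosDefKernel k) (σ : ℝ) (hX : Function.Injective X)
    (X' : Fin d' → 𝒳) : (schur k σ X X').IsHermitian := by
  have hG : (gramNoise k σ X).transpose = gramNoise k σ X := (gramNoise_posDef hk σ hX).isHermitian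
  rw [Matrix.IsHermitian, Matrix.conjTranspose_eq_transpose_of_trivial, schur,
    Matrix.transpose_sub, Matrix.transpose_mul, Matrix.transpose_mul, Matrix.transpose_nonsing_inv,
    hG, gram_transpose hk, gram_transpose hk, gram_transpose hk, Matrix.mul_assoc]

lemma schur_posSemidef (hk : IsPosDefKernel k) (σ : ℝ) (hX : Function.Injective X)
    (X' : Fin d' → 𝒳) : (schur k σ X X').PosSemidef := by
  refine .of_dotProduct_mulVec_nonneg (schur_isHermitian hk σ hX X') fun x => ?_
  obtain ⟨z, hz⟩ := schur_quadratic hk σ hX X' x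
  rw [star_trivial, hz]
  have h1 := (hk.posSemidef (Sum.elim X' X)).dotProduct_mulVec_nonneg (Sum.elim x z)
  have h2 : 0 ≤ z ⬝ᵥ z := by simpa using dotProduct_star_self_nonneg z
  rw [star_trivial] at h1
  positivity

/-- With noise, either `z ≠ 0` and `σ² |z|²` is positive, or `z = 0` and the form reduces to that of
`k(X', X')`. In the disjoint case all points together are distinct, so the joint Gram form is
positive. -/
lemma schur_posDef (hk : IsPosDefKernel k) {σ : ℝ} (hX : Function.Injective X)
    {X' : Fin d' → 𝒳} (hX' : Function.Injective X')
    (h : σ ≠ 0 ∨ Disjoint (Set.range X) (Set.range X')) : (schur k σ X X').PosDef := by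
  refine .of_dotProduct_mulVec_pos (schur_isHermitian hk σ hX X') fun x hx => ?_
  obtain ⟨z, hz⟩ := schur_quadratic hk σ hX X' x
  rw [star_trivial, hz]
  have h1 := (hk.posSemidef (Sum.elim X' X)).dotProduct_mulVec_nonneg (Sum.elim x z)
  have h2 : 0 ≤ z ⬝ᵥ z := by simpa using dotProduct_star_self_nonneg z
  rw [star_trivial] at h1
  rcases h with hσ | hdisj
  · by_cases hz0 : z = 0
    · subst hz0
      have h3 := (hk d' X' hX').dotProduct_mulVec_pos hx
      have hM : (Matrix.of fun i j => k (Sum.elim X' X i) (Sum.elim X' X j)) =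
          Matrix.fromBlocks (gram k X' X') (gram k X' X) (gram k X X') (gram k X X) := by
        ext (i | i) (j | j) <;> rfl
      rw [hM, Matrix.fromBlocks_mulVec, sumElim_dotProduct_sumElim]
      simpa using h3
    · have h3 : 0 < z ⬝ᵥ z :=
        h2.lt_of_ne fun h0 => hz0 (dotProduct_self_eq_zero.1 h0.symm)
      positivity
  · have hinj : Function.Injective (Sum.elim X' X) :=
      hX'.sumElim hX fun a b hab =>
        Set.disjoint_left.1 hdisj ⟨b, rfl⟩ ⟨a, hab⟩
    have hne : Sum.elim x z ≠ 0 := fun h0 => hx (funext fun i => congrFun h0 (Sum.inl i))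
    have h3 := (hk.posDef hinj).dotProduct_mulVec_pos hne
    rw [star_trivial] at h3
    positivity

/-- Splits `k̃` into computational uncertainty and the uncertainty that remains after an exact
solve. -/
lemma cagpCov_eq (hk : IsPosDefKernel k) (σ : ℝ) (X' : Fin d' → 𝒳)
    (D : Matrix (Fin d) (Fin d) ℝ) :
    cagpCov k X X' D =
      gram k X' X * ((gramNoise k σ X)⁻¹ - D) * (gram k X' X).transpose + schur k σ X X' := by
  rw [cagpCov, schur, gram_transpose hk, Matrix.mul_sub, Matrix.sub_mul]
  abel

lemma predictive_eq (m₀ : 𝒳 → ℝ) (σ : ℝ) (X' : Fin d' → 𝒳) :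
    predictive m₀ k σ X X' =
      fun v => multivariateGaussian (evalAt m₀ X' + app (gram k X' X) v) (schur k σ X X') :=
  rfl

end Kernel

/-! ### The regression residual and its independence of the data -/

section Regression

variable {Ω 𝒳 : Type*} [MeasurableSpace Ω] {P : Measure Ω} {m₀ : 𝒳 → ℝ} {k : 𝒳 → 𝒳 → ℝ}
  {f : 𝒳 → Ω → ℝ} {d d' : ℕ}

lemma measurable_evalAt {n : ℕ} (A : Fin n → 𝒳) :
    Measurable fun g : 𝒳 → ℝ => evalAt g A := by
  unfold evalAt
  fun_prop

lemma integral_eval_multivariateGaussian {n : ℕ} (a : Vec n) (S : Matrix (Fin n) (Fin n) ℝ)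
    (i : Fin n) : ∫ x, x i ∂(multivariateGaussian a S) = a i := by
  have h := (EuclideanSpace.proj (𝕜 := ℝ) i).integral_comp_comm
    (IsGaussian.integrable_fun_id (μ := multivariateGaussian a S))
  simpa using h

/-- Indexing by the disjoint union `Fin d' ⊕ Fin d` allows test and training points to coincide. -/
lemma hasGaussianLaw_evalAt_pair (hf : IsGaussianProcess f P) (X : Fin d → 𝒳)
    (X' : Fin d' → 𝒳) :
    HasGaussianLaw
      (fun ω => (evalAt (fun t => f t ω) X', evalAt (fun t => f t ω) X)) P := by
  have h := (hf.comp_right (Sum.elim X' X)).hasGaussianLaw Finset.univ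
  let L : (↥(Finset.univ : Finset (Fin d' ⊕ Fin d)) → ℝ) →L[ℝ] Vec d' × Vec d :=
    LinearMap.toContinuousLinearMap
      { toFun := fun x => (WithLp.toLp 2 fun i => x ⟨Sum.inl i, Finset.mem_univ _⟩,
          WithLp.toLp 2 fun i => x ⟨Sum.inr i, Finset.mem_univ _⟩)
        map_add' := fun _ _ => rfl
        map_smul' := fun _ _ => rfl }
  exact h.map_fun L

variable (hf : IsGP m₀ k f P) (X : Fin d → 𝒳) (X' : Fin d' → 𝒳) (σ : ℝ) {ζ : Ω → Vec d}
  (hζ : HasLaw ζ (multivariateGaussian 0 (σ ^ 2 • 1)) P)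
  (hfζ : IndepFun (fun ω t => f t ω) ζ P) {y : Ω → Vec d}
  (hy : ∀ ω, y ω = evalAt (fun t => f t ω) X + ζ ω)

include hf hζ hfζ hy

lemma hasGaussianLaw_joint :
    HasGaussianLaw (fun ω => (evalAt (fun t => f t ω) X', y ω)) P := by
  have hind : IndepFun (fun ω => (evalAt (fun t => f t ω) X', evalAt (fun t => f t ω) X)) ζ P :=
    hfζ.comp (φ := fun g => (evalAt g X', evalAt g X))
      ((measurable_evalAt X').prodMk (measurable_evalAt X)) measurable_id
  have h := hind.hasGaussianLaw (hasGaussianLaw_evalAt_pair hf.gaussian X X') hζ.hasGaussianLaw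
  let L : (Vec d' × Vec d) × Vec d →L[ℝ] Vec d' × Vec d :=
    ((ContinuousLinearMap.fst ℝ _ _).comp (ContinuousLinearMap.fst ℝ _ _)).prod
      ((ContinuousLinearMap.snd ℝ _ _).comp (ContinuousLinearMap.fst ℝ _ _) +
        ContinuousLinearMap.snd ℝ _ _)
  simp_rw [hy]
  exact h.map_fun L

lemma memLp_obs (i : Fin d) : MemLp (fun ω => y ω i) 2 P :=
  ((hasGaussianLaw_joint hf X X σ hζ hfζ hy).snd.map_fun (EuclideanSpace.proj i)).memLp_two

omit hfζ in
lemma integral_obs (i : Fin d) : ∫ ω, y ω i ∂P = m₀ (X i) := by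
  have hζi : ∫ ω, ζ ω i ∂P = 0 := by
    have h := hζ.integral_comp (f := fun x => x i) (by fun_prop)
    rw [integral_eval_multivariateGaussian] at h
    exact h
  have h1 : Integrable (fun ω => ζ ω i) P :=
    (hζ.hasGaussianLaw.map_fun (EuclideanSpace.proj i)).integrable
  have h2 : Integrable (f (X i)) P := (hf.gaussian.hasGaussianLaw_eval (X i)).integrable
  have h3 : ∀ ω, y ω i = f (X i) ω + ζ ω i := fun ω => by rw [hy]; rfl
  simp_rw [h3]
  rw [integral_add h2 h1, hζi, hf.mean, add_zero]

lemma cov_value_obs (t : 𝒳) (i : Fin d) : cov[f t, fun ω => y ω i; P] = k t (X i) := by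
  have := hf.gaussian.isProbabilityMeasure
  have h1 : MemLp (fun ω => ζ ω i) 2 P :=
    (hζ.hasGaussianLaw.map_fun (EuclideanSpace.proj i)).memLp_two
  have h2 : ∀ s, MemLp (f s) 2 P := fun s => (hf.gaussian.hasGaussianLaw_eval s).memLp_two
  have h3 : (fun ω => y ω i) = f (X i) + fun ω => ζ ω i := funext fun ω => by rw [hy]; rfl
  have h4 : IndepFun (f t) (fun ω => ζ ω i) P :=
    hfζ.comp (φ := fun g : 𝒳 → ℝ => g t) (ψ := fun x : Vec d => x i)
      (measurable_pi_apply _) (by fun_prop)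
  rw [h3, covariance_add_right (h2 t) (h2 _) h1, hf.cov, h4.covariance_eq_zero (h2 t) h1, add_zero]

lemma cov_obs_obs (i j : Fin d) :
    cov[fun ω => y ω i, fun ω => y ω j; P] = gramNoise k σ X i j := by
  have := hf.gaussian.isProbabilityMeasure
  have h1 : ∀ l, MemLp (fun ω => ζ ω l) 2 P := fun l =>
    (hζ.hasGaussianLaw.map_fun (EuclideanSpace.proj l)).memLp_two
  have h2 : ∀ s, MemLp (f s) 2 P := fun s => (hf.gaussian.hasGaussianLaw_eval s).memLp_two
  have h3 : ∀ l, (fun ω => y ω l) = f (X l) + fun ω => ζ ω l := fun l =>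
    funext fun ω => by rw [hy]; rfl
  have h4 : IndepFun (f (X j)) (fun ω => ζ ω i) P :=
    hfζ.comp (φ := fun g : 𝒳 → ℝ => g (X j)) (ψ := fun x : Vec d => x i) (measurable_pi_apply _) (by fun_prop)
  have h5 : cov[fun ω => ζ ω i, fun ω => ζ ω j; P] = (σ ^ 2 • (1 : Matrix _ _ ℝ)) i j := by
    rw [hζ.covariance_fun_comp (f := fun x => x i) (g := fun x => x j) (by fun_prop) (by fun_prop),
      covariance_eval_multivariateGaussian (posSemidef_smul_one σ d)]
  have h6 := cov_value_obs hf X σ hζ hfζ hy (X i) j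
  nth_rw 1 [h3 i]
  rw [covariance_add_left (h2 _) (h1 i) (memLp_obs hf X σ hζ hfζ hy j), h6, h3 j,
    covariance_add_right (h1 i) (h2 _) (h1 j), h5, covariance_comm,
    h4.covariance_eq_zero (h2 _) (h1 i), zero_add]
  rfl

variable (hk : IsPosDefKernel k) (hX : Function.Injective X)

include hk hX

lemma hasLaw_obs : HasLaw y (multivariateGaussian (evalAt m₀ X) (gramNoise k σ X)) P :=
  hasLaw_multivariateGaussian (hasGaussianLaw_joint hf X X σ hζ hfζ hy).snd
    (gramNoise_posDef hk σ hX).posSemidef (integral_obs hf X σ hζ hy)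
    (cov_obs_obs hf X σ hζ hfζ hy)

omit hf hζ hfζ hy in
lemma gain_mul_gramNoise : gram k X' X * (gramNoise k σ X)⁻¹ * gramNoise k σ X = gram k X' X := by
  have hG := gramNoise_posDef hk σ hX
  rw [Matrix.mul_assoc, Matrix.nonsing_inv_mul _ ((Matrix.isUnit_iff_isUnit_det _).1 hG.isUnit),
    Matrix.mul_one]

/-- These are the normal equations `C G = k(X', X)` for the gain `C = k(X', X) G⁻¹`. -/
lemma cov_residual_obs (i : Fin d') (j : Fin d) :
    cov[fun ω => f (X' i) ω - ∑ l, (gram k X' X * (gramNoise k σ X)⁻¹) i l * y ω l,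
      fun ω => y ω j; P] = 0 := by
  have := hf.gaussian.isProbabilityMeasure
  have hyi := memLp_obs hf X σ hζ hfζ hy
  have hfi : MemLp (f (X' i)) 2 P := (hf.gaussian.hasGaussianLaw_eval _).memLp_two
  rw [covariance_fun_sub_left hfi (memLp_finsetSum _ fun l _ => (hyi l).const_mul _) (hyi j),
    covariance_fun_sum_left (fun l => (hyi l).const_mul _) (hyi j),
    cov_value_obs hf X σ hζ hfζ hy]
  simp_rw [covariance_const_mul_left, cov_obs_obs hf X σ hζ hfζ hy]
  have h := congrFun (congrFun (gain_mul_gramNoise X X' σ hk hX) i) j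
  rw [Matrix.mul_apply] at h
  rw [h]
  exact sub_self _

/-- As the residual is uncorrelated with `y`, its second copy can be replaced by `f(X' j)`. -/
lemma cov_residual_residual (i j : Fin d') :
    cov[fun ω => f (X' i) ω - ∑ l, (gram k X' X * (gramNoise k σ X)⁻¹) i l * y ω l,
      fun ω => f (X' j) ω - ∑ l, (gram k X' X * (gramNoise k σ X)⁻¹) j l * y ω l; P] =
        schur k σ X X' i j := by
  have := hf.gaussian.isProbabilityMeasure
  have hyi := memLp_obs hf X σ hζ hfζ hy
  have hfi : ∀ t, MemLp (f t) 2 P := fun t => (hf.gaussian.hasGaussianLaw_eval _).memLp_two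
  have hsum : ∀ i, MemLp
      (fun ω => ∑ l, (gram k X' X * (gramNoise k σ X)⁻¹) i l * y ω l) 2 P := fun i =>
    memLp_finsetSum _ fun l _ => (hyi l).const_mul _
  have hres : MemLp
      (fun ω => f (X' i) ω - ∑ l, (gram k X' X * (gramNoise k σ X)⁻¹) i l * y ω l) 2 P :=
    (hfi (X' i)).sub (hsum i)
  rw [covariance_fun_sub_right hres (hfi _) (hsum j),
    covariance_fun_sum_right (fun l => (hyi l).const_mul _) hres]
  simp_rw [covariance_const_mul_right, cov_residual_obs hf X X' σ hζ hfζ hy hk hX]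
  rw [covariance_fun_sub_left (hfi _) (hsum i) (hfi _),
    covariance_fun_sum_left (fun l => (hyi l).const_mul _) (hfi _), hf.cov]
  simp_rw [covariance_const_mul_left, covariance_comm _ (f (X' j)),
    cov_value_obs hf X σ hζ hfζ hy, hk.symm (X' j)]
  simp only [mul_zero, Finset.sum_const_zero, sub_zero]
  rw [schur, Matrix.sub_apply, Matrix.mul_apply]
  rfl

/-- Residual and data form a linear image of a Gaussian pair, so vanishing covariance gives
independence. -/
lemma residual_indep_and_law :
    IndepFun (fun ω => evalAt (fun t => f t ω) X' - evalAt m₀ X' -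
        app (gram k X' X * (gramNoise k σ X)⁻¹) (y ω - evalAt m₀ X))
      (fun ω => y ω - evalAt m₀ X) P ∧
    HasLaw (fun ω => evalAt (fun t => f t ω) X' - evalAt m₀ X' -
        app (gram k X' X * (gramNoise k σ X)⁻¹) (y ω - evalAt m₀ X))
      (multivariateGaussian 0 (schur k σ X X')) P := by
  have := hf.gaussian.isProbabilityMeasure
  set C := gram k X' X * (gramNoise k σ X)⁻¹ with hC
  let L : Vec d' × Vec d →L[ℝ] Vec d' × Vec d :=
    (ContinuousLinearMap.fst ℝ _ _ - (appCLM C).comp (ContinuousLinearMap.snd ℝ _ _)).prod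
      (ContinuousLinearMap.snd ℝ _ _)
  have hpair : HasGaussianLaw (fun ω => (evalAt (fun t => f t ω) X' - app C (y ω), y ω)) P :=
    (hasGaussianLaw_joint hf X X' σ hζ hfζ hy).map_fun L
  set r : Ω → Vec d' := fun ω => evalAt (fun t => f t ω) X' - app C (y ω) with hr
  have hri : ∀ i, (fun ω => r ω i) = fun ω => f (X' i) ω - ∑ l, C i l * y ω l := fun i => rfl
  have hind : IndepFun r y P := by
    let L2 : Vec d' × Vec d →L[ℝ] (Fin d' → ℝ) × (Fin d → ℝ) :=
      ((PiLp.continuousLinearEquiv 2 ℝ fun _ : Fin d' => ℝ).toContinuousLinearMap.comp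
        (ContinuousLinearMap.fst ℝ _ _)).prod
      ((PiLp.continuousLinearEquiv 2 ℝ fun _ : Fin d => ℝ).toContinuousLinearMap.comp
        (ContinuousLinearMap.snd ℝ _ _))
    have h := HasGaussianLaw.indepFun_of_covariance_eval
      (X := fun i ω => r ω i) (Y := fun j ω => y ω j) (hpair.map_fun L2) fun i j => by
        rw [hri]; exact cov_residual_obs hf X X' σ hζ hfζ hy hk hX i j
    exact h.comp (φ := WithLp.toLp 2) (ψ := WithLp.toLp 2) (by fun_prop) (by fun_prop)
  have hlaw : HasLaw r (multivariateGaussian (evalAt m₀ X' - app C (evalAt m₀ X))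
      (schur k σ X X')) P := by
    refine hasLaw_multivariateGaussian hpair.fst (schur_posSemidef hk σ hX X') (fun i => ?_)
      fun i j => ?_
    · have hyi : ∀ l, Integrable (fun ω => C i l * y ω l) P := fun l =>
        ((memLp_obs hf X σ hζ hfζ hy l).integrable (by norm_num)).const_mul _
      change ∫ ω, (f (X' i) ω - ∑ l, C i l * y ω l) ∂P = _
      rw [integral_sub (hf.gaussian.hasGaussianLaw_eval _).integrable
        (integrable_finsetSum _ fun l _ => hyi l), integral_finsetSum _ fun l _ => hyi l, hf.mean]
      simp_rw [integral_const_mul, integral_obs hf X σ hζ hy]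
      rfl
    · rw [hri, hri]
      exact cov_residual_residual hf X X' σ hζ hfζ hy hk hX i j
  have hshift : (fun ω => evalAt (fun t => f t ω) X' - evalAt m₀ X' - app C (y ω - evalAt m₀ X)) =
      fun ω => -(evalAt m₀ X' - app C (evalAt m₀ X)) + app 1 (r ω) := by
    funext ω
    simp only [app_one, app_sub, hr]
    abel
  constructor
  · rw [hshift]
    exact hind.comp (φ := fun x => -(evalAt m₀ X' - app C (evalAt m₀ X)) + app 1 x)
      (ψ := fun x => x - evalAt m₀ X) (by fun_prop) (by fun_prop)
  · rw [hshift]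
    have h := hasLaw_affine (schur_posSemidef hk σ hX X') hlaw
      (-(evalAt m₀ X' - app C (evalAt m₀ X))) 1
    rwa [app_one, neg_add_cancel, Matrix.one_mul, Matrix.transpose_one, Matrix.mul_one] at h

end Regression

/-! ### The law of the posterior error -/

section Error

variable {Ω 𝒳 : Type*} [MeasurableSpace Ω] {P : Measure Ω} {m₀ : 𝒳 → ℝ} {k : 𝒳 → 𝒳 → ℝ}
  {f : 𝒳 → Ω → ℝ} {d d' : ℕ}

/-- The law of the error `m̃ - f(X')` of the computation-aware posterior mean. It is the sum of
`k(X', X) (v̄ - v)` for the representer weights `v = G⁻¹ (y - m₀(X))`, which is a function of the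
data, and of the negative regression residual, which is independent of the data. In
particular `f(X') - k(X', X) v` is uncorrelated with `v̄`, so that the relation
`Cov(f(X'), v̄) = k(X', X) G⁻¹ Cov(y, v̄)` holds for every strongly calibrated solver and need not be
assumed here. -/
lemma hasLaw_error (hf : IsGP m₀ k f P) (X : Fin d → 𝒳) (X' : Fin d' → 𝒳) (σ : ℝ) {ζ : Ω → Vec d}
    (hζ : HasLaw ζ (multivariateGaussian 0 (σ ^ 2 • 1)) P)
    (hfζ : IndepFun (fun ω t => f t ω) ζ P) {y : Ω → Vec d}
    (hy : ∀ ω, y ω = evalAt (fun t => f t ω) X + ζ ω)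
    (hk : IsPosDefKernel k) (hX : Function.Injective X) {vbar : Vec d → Vec d}
    {S : Matrix (Fin d) (Fin d) ℝ} (hS : S.PosSemidef)
    (hsolver : HasLaw (fun v => vbar (app (gramNoise k σ X) v) - id v)
      (multivariateGaussian 0 S) (inversePrior k σ X)) :
    HasLaw (fun ω => cagpMean m₀ k X X' (vbar (y ω - evalAt m₀ X)) -
        evalAt (fun t => f t ω) X')
      (multivariateGaussian 0 (gram k X' X * S * (gram k X' X).transpose + schur k σ X X')) P := by
  have hG := gramNoise_posDef hk σ hX
  have hT := schur_posSemidef hk σ hX X'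
  have hdet : IsUnit (gramNoise k σ X).det :=
    (Matrix.isUnit_iff_isUnit_det _).1 hG.isUnit
  have hGt : (gramNoise k σ X).transpose = gramNoise k σ X := hG.isHermitian
  have hv : HasLaw (fun ω => app (gramNoise k σ X)⁻¹ (y ω - evalAt m₀ X))
      (inversePrior k σ X) P := by
    have h := hasLaw_affine hG.posSemidef (hasLaw_obs hf X σ hζ hfζ hy hk hX)
      (-app (gramNoise k σ X)⁻¹ (evalAt m₀ X)) (gramNoise k σ X)⁻¹
    rw [neg_add_cancel, Matrix.transpose_nonsing_inv, hGt, Matrix.nonsing_inv_mul _ hdet,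
      Matrix.one_mul] at h
    refine h.congr (.of_forall fun ω => ?_)
    simp only [app_sub]
    abel
  have he := hsolver.fun_comp hv
  obtain ⟨hind, hres⟩ := residual_indep_and_law hf X X' σ hζ hfζ hy hk hX
  -- The solver mean `vbar` need not be measurable. Only almost everywhere measurability of `v̄(G v)
  -- - v` under the law of `v` is available, from the calibration law; hence `comp₀`.
  have hind' := (hind.comp (φ := id) (ψ := app (gramNoise k σ X)⁻¹) measurable_id
    (by fun_prop)).comp₀ hres.aemeasurable hv.aemeasurable
    (φ := app (-1 : Matrix (Fin d') (Fin d') ℝ))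
    (ψ := fun v => app (gram k X' X) (vbar (app (gramNoise k σ X) v) - id v))
    (measurable_app _).aemeasurable
    ((measurable_app _).comp_aemeasurable (by
      have := hsolver.aemeasurable
      rwa [← hv.map_eq] at this))
  have h := hasLaw_add (posSemidef_conj hS (gram k X' X)) (posSemidef_conj hT (-1))
    (hasLaw_app hS he (gram k X' X)) (hasLaw_app hT hres (-1)) hind'.symm
  rw [add_zero, Matrix.transpose_neg, Matrix.transpose_one, Matrix.mul_neg, Matrix.mul_one,
    Matrix.neg_mul, Matrix.one_mul, neg_neg] at h
  refine h.congr (.of_forall fun ω => ?_)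
  have hneg : ∀ x : Vec d', app (-1) x = -x := fun x => by simp [app, Matrix.neg_mulVec]
  simp only [app_app (gramNoise k σ X), Matrix.mul_nonsing_inv _ hdet,
    app_one, id, app_sub (gram k X' X), hneg, app_app (gram k X' X), cagpMean]
  abel

end Error

end CAGP

end

theorem mainTheorem1 {Ω 𝒳 : Type*} [MeasurableSpace Ω] (P : Measure Ω) [IsProbabilityMeasure P]
    -- the prior `f ~ GP(m₀, k)` with a positive definite kernel
    (m₀ : 𝒳 → ℝ) (k : 𝒳 → 𝒳 → ℝ) (hk : CAGP.IsPosDefKernel k)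
    (f : 𝒳 → Ω → ℝ) (hf : CAGP.IsGP m₀ k f P)
    -- distinct training points, arbitrary test points
    {d d' : ℕ} (X : Fin d → 𝒳) (hX : Function.Injective X) (X' : Fin d' → 𝒳)
    -- observations `y = f(X) + ζ` with noise `ζ ~ N(0, σ² I)` independent of `f`
    (σ : ℝ) (ζ : Ω → CAGP.Vec d) (hζ : HasLaw ζ (multivariateGaussian 0 (σ ^ 2 • 1)) P)
    (hfζ : IndepFun (fun ω t => f t ω) ζ P)
    (y : Ω → CAGP.Vec d) (hy : ∀ ω, y ω = CAGP.evalAt (fun t => f t ω) X + ζ ω)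
    -- the solver returns `N(v̄(b), G⁻¹ - D)`, with `D` the same for all data
    (η : CAGP.LearningProcedure (CAGP.Vec d) (CAGP.Vec d))
    (vbar : CAGP.Vec d → CAGP.Vec d) (D : Matrix (Fin d) (Fin d) ℝ)
    (hη : ∀ b, CAGP.IsGaussianDist (η (CAGP.inversePrior k σ X) b) (vbar b)
      ((CAGP.gramNoise k σ X)⁻¹ - D))
    -- the solver is strongly calibrated for `N(0, G⁻¹)`
    (hcal : CAGP.CalibratedPLS (CAGP.gramNoise k σ X) (CAGP.inversePrior k σ X) η)
    -- `Cov(f(X'), v̄) = k(X', X) G⁻¹ Cov(y, v̄)`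
    (hcross :
      CAGP.crossCov P (fun ω => CAGP.evalAt (fun t => f t ω) X')
          (fun ω => vbar (y ω - CAGP.evalAt m₀ X)) =
        CAGP.gram k X' X * (CAGP.gramNoise k σ X)⁻¹ *
          CAGP.crossCov P y (fun ω => vbar (y ω - CAGP.evalAt m₀ X))) :
    -- the induced posterior is `N(m̃, k̃)`
    (∀ z, CAGP.IsGaussianDist (CAGP.cagpPosterior m₀ k σ X X' η z)
      (CAGP.cagpMean m₀ k X X' (vbar (z - CAGP.evalAt m₀ X))) (CAGP.cagpCov k X X' D)) ∧
    -- it is strongly calibrated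
    CAGP.StronglyCalibrated P (fun ω => CAGP.evalAt (fun t => f t ω) X') y
      (CAGP.cagpPosterior m₀ k σ X X' η) ∧
    -- for distinct test points (which are not training points, if there is no noise), `k̃` is
    -- positive definite and `k̃^{-1/2} (m̃ - f(X')) ~ N(0, I)`
    (Function.Injective X' → (σ ≠ 0 ∨ Disjoint (Set.range X) (Set.range X')) →
      (CAGP.cagpCov k X X' D).PosDef ∧
      HasLaw (fun ω => CAGP.app (CAGP.invSqrt (CAGP.cagpCov k X X' D))
          (CAGP.cagpMean m₀ k X X' (vbar (y ω - CAGP.evalAt m₀ X)) -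
            CAGP.evalAt (fun t => f t ω) X'))
        (stdGaussian (CAGP.Vec d')) P) := by
  have hT := CAGP.schur_posSemidef hk σ hX X'
  -- The right-hand side `0` is arbitrary: the covariance is the same for all.
  have hS : ((CAGP.gramNoise k σ X)⁻¹ - D).PosSemidef := (hη 0).1
  have hcov := CAGP.cagpCov_eq (X := X) hk σ X' D
  have hcovS : (CAGP.cagpCov k X X' D).PosSemidef := by
    rw [hcov]
    exact (CAGP.posSemidef_conj hS _).add hT
  have hpost : ∀ z, CAGP.IsGaussianDist (CAGP.cagpPosterior m₀ k σ X X' η z)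
      (CAGP.cagpMean m₀ k X X' (vbar (z - CAGP.evalAt m₀ X))) (CAGP.cagpCov k X X' D) := by
    refine fun z => ⟨hcovS, ?_⟩
    rw [CAGP.cagpPosterior, (hη _).2, CAGP.predictive_eq,
      CAGP.bind_multivariateGaussian hS hT, hcov, CAGP.cagpMean]
  have herr := CAGP.hasLaw_error hf X X' σ hζ hfζ hy hk hX hS (hcal.hasLaw hη)
  rw [← hcov] at herr
  refine ⟨hpost, CAGP.stronglyCalibrated_of_hasLaw hpost hcovS herr, fun hX' hdisj => ?_⟩
  have hpd : (CAGP.cagpCov k X X' D).PosDef := by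
    rw [hcov]
    exact (CAGP.schur_posDef hk hX hX' hdisj).posSemidef_add (CAGP.posSemidef_conj hS _)
  exact ⟨hpd, CAGP.hasLaw_invSqrt hpd herr⟩
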